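/- A commutative involutive residuated lattice is an algebra ${\bf A}=(A,\vee,\wedge,\cdot,\to,e,\sim)$ such that $(A,\vee,\wedge)$ is a lattice, $(A,\cdot,e)$ is a commutative monoid, $x\cdot y\le z$ iff $y\le x\to z$, and $\sim\sim x=x$, $x\to\sim y=y\to\sim x$. A Nelson-type algebra is such an algebra whose lattice reduct is distributive and which satisfies $$xy=(x\wedge e)^2y\vee x(y\wedge e)^2,\qquad (xy\wedge e)^2=(x\wedge e)^2(y\wedge e)^2 .$$ It is integral if $x\le e$ for all $x$, and odd if $\sim e=e$. A Nelson residuated lattice is an algebra $(A,\vee,\wedge,\cdot,\to,e,\bot)$ whose reduct $(A,\vee,\wedge,\cdot,\to,e)$ is an integral commutative residuated lattice with least element $\bot$ such that, with $\neg x:=x\to\bot$, $\neg\neg x=x$ and $(x^2\to y)\wedge((\neg y)^2\to\neg x)=x\to y$. An NPc-lattice (Nelson paraconsistent residuated lattice) is a distributive commutative residuated lattice $(A,\vee,\wedge,\cdot,\to,e)$ such that, with $\sim x:=x\to e$, $\sim\sim x=x$, $(xy)\wedge e=(x\wedge e)(y\wedge e)$, $(x\wedge e)^2=x\wedge e$ and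 $((x\wedge e)\to y)\wedge(x\to(y\vee e))=x\to y$. Both kinds of algebras are regarded as algebras of signature $(\vee,\wedge,\cdot,\to,e,\sim)$, with $\sim x:=x\to\bot$ (in place of the constant $\bot$) and $\sim x:=x\to e$, respectively. A variety is a class of algebras of signature $(\vee,\wedge,\cdot,\to,e,\sim)$ that is closed under homomorphic images, (isomorphic copies of) subalgebras and direct products. The variety generated by a class is the smallest variety containing it, and the join of two varieties is the smallest variety containing both. **Lemma.** Let $\mathcal{NT}_0$ be the class of all Nelson-type algebras satisfying $e\le\ \sim e\vee(\sim e\to x)$ for all $x$. Then $\mathcal{NT}_0$ is a variety, and it is the variety generated by the integral Nelson-type algebras together with the odd Nelson-type algebras. Moreover the Nelson residuated lattices and the NPc-lattices, in the signature above, form varieties, and $\mathcal{NT}_0$ is their join. -/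

import Mathlib

universe u

namespace NelsonType

/-- An algebra of the signature `(∨, ∧, ·, →, e)`, with no laws imposed. -/
structure ResAlg : Type (u + 1) where
  carrier : Type u
  sup : carrier → carrier → carrier
  inf : carrier → carrier → carrier
  mul : carrier → carrier → carrier
  imp : carrier → carrier → carrier
  one : carrier

/-- An algebra of the signature `(∨, ∧, ·, →, e, ⊥)`, with no laws imposed. -/
structure BddAlg : Type (u + 1) extends ResAlg.{u} where
  bot : carrier

/-- An algebra of the signature `(∨, ∧, ·, →, e, ∼)`, with no laws imposed. -/
structure InvAlg : Type (u + 1) extends ResAlg.{u} where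
  neg : carrier → carrier

/-- The lattice order. -/
def ResAlg.le (A : ResAlg.{u}) (x y : A.carrier) : Prop := A.inf x y = x

/-- Commutative residuated lattices. -/
structure IsCommResLattice (A : ResAlg.{u}) : Prop where
  sup_comm : ∀ x y, A.sup x y = A.sup y x
  sup_assoc : ∀ x y z, A.sup (A.sup x y) z = A.sup x (A.sup y z)
  inf_comm : ∀ x y, A.inf x y = A.inf y x
  inf_assoc : ∀ x y z, A.inf (A.inf x y) z = A.inf x (A.inf y z)
  sup_inf_self : ∀ x y, A.sup x (A.inf x y) = x
  inf_sup_self : ∀ x y, A.inf x (A.sup x y) = x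
  mul_assoc : ∀ x y z, A.mul (A.mul x y) z = A.mul x (A.mul y z)
  mul_comm : ∀ x y, A.mul x y = A.mul y x
  one_mul : ∀ x, A.mul A.one x = x
  residuation : ∀ x y z, A.le (A.mul x y) z ↔ A.le y (A.imp x z)

/-- Distributivity of the lattice reduct. -/
def IsDistrib (A : ResAlg.{u}) : Prop :=
  ∀ x y z, A.inf x (A.sup y z) = A.sup (A.inf x y) (A.inf x z)

/-- Integrality: `x ≤ e`. -/
def IsIntegral (A : ResAlg.{u}) : Prop := ∀ x, A.le x A.one

/-- The square `x² = x · x`. -/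
def ResAlg.sq (A : ResAlg.{u}) (x : A.carrier) : A.carrier := A.mul x x

/-- The term `(x ∧ e)²`. -/
def ResAlg.tw (A : ResAlg.{u}) (x : A.carrier) : A.carrier := A.sq (A.inf x A.one)

/-- Commutative involutive residuated lattices. -/
structure IsCommInvResLattice (A : InvAlg.{u}) : Prop where
  isCommResLattice : IsCommResLattice A.toResAlg
  neg_neg : ∀ x, A.neg (A.neg x) = x
  contraposition : ∀ x y, A.imp x (A.neg y) = A.imp y (A.neg x)

/-- Nelson-type algebras. -/
structure IsNelsonType (A : InvAlg.{u}) : Prop where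
  isCommInvResLattice : IsCommInvResLattice A
  isDistrib : IsDistrib A.toResAlg
  mul_eq : ∀ x y, A.mul x y = A.sup (A.mul (A.tw x) y) (A.mul x (A.tw y))
  tw_mul : ∀ x y, A.tw (A.mul x y) = A.mul (A.tw x) (A.tw y)

/-- The class of Nelson-type algebras satisfying `e ≤ ∼e ∨ (∼e → x)`. -/
def NT0 : Set InvAlg.{u} :=
  {A | IsNelsonType A ∧
    ∀ x, A.le A.one (A.sup (A.neg A.one) (A.imp (A.neg A.one) x))}

/-- The class of integral Nelson-type algebras. -/
def IntegralNT : Set InvAlg.{u} := {A | IsNelsonType A ∧ IsIntegral A.toResAlg}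

/-- The class of odd Nelson-type algebras. -/
def OddNT : Set InvAlg.{u} := {A | IsNelsonType A ∧ A.neg A.one = A.one}

/-- The definable negation `¬x = x → ⊥`. -/
def BddAlg.neg (B : BddAlg.{u}) (x : B.carrier) : B.carrier := B.imp x B.bot

/-- Nelson residuated lattices, in the signature `(∨, ∧, ·, →, e, ⊥)`. -/
structure IsNelsonResLattice (B : BddAlg.{u}) : Prop where
  isCommResLattice : IsCommResLattice B.toResAlg
  isIntegral : IsIntegral B.toResAlg
  bot_le : ∀ x, B.le B.bot x
  neg_neg : ∀ x, B.neg (B.neg x) = x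
  nelson : ∀ x y,
    B.inf (B.imp (B.sq x) y) (B.imp (B.sq (B.neg y)) (B.neg x)) = B.imp x y

/-- The definable negation `∼x = x → e`. -/
def ResAlg.oddNeg (B : ResAlg.{u}) (x : B.carrier) : B.carrier := B.imp x B.one

/-- Nelson paraconsistent residuated lattices (NPc-lattices), in the signature
`(∨, ∧, ·, →, e)`. -/
structure IsNPcLattice (B : ResAlg.{u}) : Prop where
  isCommResLattice : IsCommResLattice B
  isDistrib : IsDistrib B
  neg_neg : ∀ x, B.oddNeg (B.oddNeg x) = x
  mul_inf_one : ∀ x y,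
    B.inf (B.mul x y) B.one = B.mul (B.inf x B.one) (B.inf y B.one)
  sq_inf_one : ∀ x, B.sq (B.inf x B.one) = B.inf x B.one
  nelson : ∀ x y,
    B.inf (B.imp (B.inf x B.one) y) (B.imp x (B.sup y B.one)) = B.imp x y

/-- The translation to the signature with an involution, `∼x := x → ⊥`. -/
def BddAlg.toInv (B : BddAlg.{u}) : InvAlg.{u} where
  toResAlg := B.toResAlg
  neg := B.neg

/-- The translation to the signature with an involution, `∼x := x → e`. -/
def ResAlg.toInv (B : ResAlg.{u}) : InvAlg.{u} where
  toResAlg := B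
  neg := B.oddNeg

/-- The class of Nelson residuated lattices, in the signature with an involution. -/
def NelsonRL : Set InvAlg.{u} := {A | ∃ B : BddAlg.{u}, IsNelsonResLattice B ∧ B.toInv = A}

/-- The class of NPc-lattices, in the signature with an involution. -/
def NPcL : Set InvAlg.{u} := {A | ∃ B : ResAlg.{u}, IsNPcLattice B ∧ B.toInv = A}

/-- Homomorphisms of algebras of the signature `(∨, ∧, ·, →, e, ∼)`. -/
structure IsHom (A B : InvAlg.{u}) (f : A.carrier → B.carrier) : Prop where
  map_sup : ∀ x y, f (A.sup x y) = B.sup (f x) (f y)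
  map_inf : ∀ x y, f (A.inf x y) = B.inf (f x) (f y)
  map_mul : ∀ x y, f (A.mul x y) = B.mul (f x) (f y)
  map_imp : ∀ x y, f (A.imp x y) = B.imp (f x) (f y)
  map_one : f A.one = B.one
  map_neg : ∀ x, f (A.neg x) = B.neg (f x)

/-- Direct products, with the operations defined coordinatewise. -/
def prod {ι : Type u} (A : ι → InvAlg.{u}) : InvAlg.{u} where
  carrier := ∀ i, (A i).carrier
  sup x y := fun i => (A i).sup (x i) (y i)
  inf x y := fun i => (A i).inf (x i) (y i)
  mul x y := fun i => (A i).mul (x i) (y i)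
  imp x y := fun i => (A i).imp (x i) (y i)
  one := fun i => (A i).one
  neg x := fun i => (A i).neg (x i)

/-- A variety: a class of algebras of the given signature that is closed under homomorphic
images, (isomorphic copies of) subalgebras, and direct products. -/
structure IsVariety (V : Set InvAlg.{u}) : Prop where
  image : ∀ (A B : InvAlg.{u}) (f : A.carrier → B.carrier),
    IsHom A B f → Function.Surjective f → A ∈ V → B ∈ V
  subalgebra : ∀ (A B : InvAlg.{u}) (f : B.carrier → A.carrier),
    IsHom B A f → Function.Injective f → A ∈ V → B ∈ V
  product : ∀ (ι : Type u) (A : ι → InvAlg.{u}), (∀ i, A i ∈ V) → prod A ∈ V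

/-- The variety generated by a class: the intersection of all varieties that contain it. -/
def generatedVariety (K : Set InvAlg.{u}) : Set InvAlg.{u} :=
  {A | ∀ V : Set InvAlg.{u}, IsVariety V → K ⊆ V → A ∈ V}

/-- The join of two varieties: the smallest variety that contains both. -/
def varietyJoin (V W : Set InvAlg.{u}) : Set InvAlg.{u} := generatedVariety (V ∪ W)

end NelsonType

/-! All the classes are equational, hence varieties. Write f for `∼e`. Since x ≤ y iff x·∼y ≤ f, the
identity for xy in a Nelson-type algebra becomes the Nelson identity for x → y when the algebra is
integral or odd. Thus Nelson residuated lattices are exactly the integral Nelson-type algebras and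
NPc-lattices the odd ones; both classes lie in `NT0`.

The remaining inclusion is a subdirect decomposition. A submonoid F of the negative cone gives a
congruence: x ≡ y when xp ≤ y and yq ≤ x for some p, q in F. For F = {p ≤ e : f² ≤ p} the quotient
is odd, because f² ∈ F. For F = {p ≤ e : e ≤ f ∨ p} it is integral, because the law e ≤ f ∨ (f → ∼x)
puts e ∧ (f → ∼x) in F. If xp ≤ y and xq ≤ y with p in the first and q in the second, then e ≤ (f ∨
q)² ≤ f² ∨ q ≤ p ∨ q, so x ≤ y. Hence the algebra embeds in the product of its two quotients
(`le_of_leMod_of_leMod`, `leMod_odd`, `leMod_integral`). -/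

namespace NelsonType

/-! ### Equational classes -/

/-- Terms of the signature `(∨, ∧, ·, →, e, ∼)` in three variables. -/
inductive Term : Type
  | x | y | z | one
  | sup (s t : Term)
  | inf (s t : Term)
  | mul (s t : Term)
  | imp (s t : Term)
  | neg (t : Term)

namespace Term

/-- The value of a term. -/
def eval (A : InvAlg.{u}) (a b c : A.carrier) : Term → A.carrier
  | x => a
  | y => b
  | z => c
  | one => A.one
  | sup s t => A.sup (s.eval A a b c) (t.eval A a b c)
  | inf s t => A.inf (s.eval A a b c) (t.eval A a b c)
  | mul s t => A.mul (s.eval A a b c) (t.eval A a b c)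
  | imp s t => A.imp (s.eval A a b c) (t.eval A a b c)
  | neg t => A.neg (t.eval A a b c)

/-- The equation expressing `s ≤ t`. -/
def leEq (s t : Term) : Term × Term := (inf s t, s)

/-- The term `(t ∧ e)²`. -/
def tw (t : Term) : Term := mul (inf t one) (inf t one)

theorem map_eval {A B : InvAlg.{u}} {f : A.carrier → B.carrier} (hf : IsHom A B f)
    (a b c : A.carrier) (t : Term) : f (t.eval A a b c) = t.eval B (f a) (f b) (f c) := by
  induction t with
  | x => rfl
  | y => rfl
  | z => rfl
  | one => exact hf.map_one
  | sup s t hs ht => simp only [eval, hf.map_sup, hs, ht]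
  | inf s t hs ht => simp only [eval, hf.map_inf, hs, ht]
  | mul s t hs ht => simp only [eval, hf.map_mul, hs, ht]
  | imp s t hs ht => simp only [eval, hf.map_imp, hs, ht]
  | neg t ht => simp only [eval, hf.map_neg, ht]

end Term

theorem isHom_proj {ι : Type u} (A : ι → InvAlg.{u}) (i : ι) :
    IsHom (prod A) (A i) (fun v => v i) where
  map_sup _ _ := rfl
  map_inf _ _ := rfl
  map_mul _ _ := rfl
  map_imp _ _ := rfl
  map_one := rfl
  map_neg _ := rfl

/-- The class of all algebras satisfying a list of equations. -/
def models (E : List (Term × Term)) : Set InvAlg.{u} :=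
  {A | ∀ p ∈ E, ∀ a b c, p.1.eval A a b c = p.2.eval A a b c}

theorem isVariety_models (E : List (Term × Term)) : IsVariety (models.{u} E) where
  image A B f hf hs hA p hp a b c := by
    obtain ⟨a, rfl⟩ := hs a
    obtain ⟨b, rfl⟩ := hs b
    obtain ⟨c, rfl⟩ := hs c
    rw [← Term.map_eval hf, ← Term.map_eval hf, hA p hp]
  subalgebra A B f hf hi hA p hp a b c := by
    apply hi
    rw [Term.map_eval hf, Term.map_eval hf, hA p hp]
  product ι A hA p hp a b c := by
    funext i
    exact (Term.map_eval (isHom_proj A i) a b c p.1).trans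
      ((hA i p hp _ _ _).trans (Term.map_eval (isHom_proj A i) a b c p.2).symm)

theorem mem_models_append {E F : List (Term × Term)} {A : InvAlg.{u}} :
    A ∈ models (E ++ F) ↔ A ∈ models E ∧ A ∈ models F := by
  simp only [models, Set.mem_ofPred_eq, List.mem_append, or_imp, forall_and]

/-! ### Commutative residuated lattices as a type class -/

/-- Commutative residuated lattices. -/
class CommResLat (α : Type*) extends Lattice α, CommMonoid α where
  imp : α → α → α
  mul_le_iff : ∀ x y z : α, x * y ≤ z ↔ y ≤ imp x z

/-- Commutative residuated lattices with a compatible involution. -/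
class InvResLat (α : Type*) extends CommResLat α where
  neg : α → α
  neg_neg : ∀ x : α, neg (neg x) = x
  imp_neg : ∀ x y : α, imp x (neg y) = imp y (neg x)

namespace CommResLat

variable {α : Type*} [CommResLat α]

instance : IsOrderedMonoid α where
  mul_le_mul_left a b hab c := by
    rw [mul_comm a, mul_comm b, mul_le_iff]
    exact hab.trans ((mul_le_iff _ _ _).1 le_rfl)

theorem mul_sup_eq (x y z : α) : x * (y ⊔ z) = x * y ⊔ x * z := by
  apply le_antisymm
  · rw [mul_le_iff]
    exact sup_le ((mul_le_iff _ _ _).1 le_sup_left) ((mul_le_iff _ _ _).1 le_sup_right)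
  · exact sup_le (mul_le_mul_right le_sup_left x) (mul_le_mul_right le_sup_right x)

theorem sup_mul_eq (x y z : α) : (y ⊔ z) * x = y * x ⊔ z * x := by
  rw [mul_comm, mul_sup_eq, mul_comm x, mul_comm x]

theorem mul_imp_le (x y : α) : x * imp x y ≤ y := (mul_le_iff _ _ _).2 le_rfl

theorem le_imp_mul (x y : α) : y ≤ imp x (x * y) := (mul_le_iff _ _ _).1 le_rfl

theorem imp_mono_right (x : α) {y z : α} (h : y ≤ z) : imp x y ≤ imp x z :=
  (mul_le_iff _ _ _).1 ((mul_imp_le x y).trans h)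

theorem one_imp (x : α) : imp 1 x = x := by
  apply le_antisymm
  · simpa using mul_imp_le 1 x
  · simpa using le_imp_mul 1 x

theorem mul_le_left_of_le_one {x p : α} (hp : p ≤ 1) : x * p ≤ x := by
  simpa using mul_le_mul_right hp x

theorem mul_le_right_of_le_one {x p : α} (hp : p ≤ 1) : p * x ≤ x := by
  rw [mul_comm]
  exact mul_le_left_of_le_one hp

theorem inf_one_sq_le (x : α) : (x ⊓ 1) * (x ⊓ 1) ≤ x ⊓ 1 :=
  mul_le_left_of_le_one inf_le_right

theorem imp_imp_comm (x y z : α) : imp x (imp y z) = imp y (imp x z) := by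
  refine eq_of_forall_le_iff fun w => ?_
  rw [← mul_le_iff, ← mul_le_iff, ← mul_le_iff, ← mul_le_iff, mul_left_comm]

end CommResLat

open CommResLat

namespace InvResLat

variable {α : Type*} [InvResLat α]

theorem imp_neg_one (x : α) : imp x (neg 1) = neg x := by
  rw [imp_neg, one_imp]

/-- `neg 1` is a dualizing element: order questions become questions of which products lie below it,
where identities for products apply. -/
theorem le_neg_iff (x y : α) : x ≤ neg y ↔ x * y ≤ neg 1 := by
  rw [← imp_neg_one y, ← mul_le_iff, mul_comm]

theorem le_iff_mul_neg (x y : α) : x ≤ y ↔ x * neg y ≤ neg 1 := by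
  rw [← le_neg_iff, neg_neg]

theorem mul_neg_le (x : α) : x * neg x ≤ neg 1 := (le_iff_mul_neg x x).1 le_rfl

theorem neg_le_neg {x y : α} (h : x ≤ y) : neg y ≤ neg x := by
  rw [le_neg_iff, mul_comm]
  exact (le_iff_mul_neg x y).1 h

theorem neg_sup (x y : α) : neg (x ⊔ y) = neg x ⊓ neg y := by
  refine eq_of_forall_le_iff fun z => ?_
  rw [le_inf_iff, le_neg_iff z x, le_neg_iff z y, le_neg_iff, mul_sup_eq, sup_le_iff]

theorem neg_inf (x y : α) : neg (x ⊓ y) = neg x ⊔ neg y := by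
  rw [← neg_neg (neg x ⊔ neg y), neg_sup, neg_neg, neg_neg]

theorem le_of_forall_mul_le {x y : α} (h : ∀ z, z * y ≤ neg 1 → z * x ≤ neg 1) : x ≤ y := by
  rw [le_iff_mul_neg, mul_comm]
  exact h _ (by rw [mul_comm]; exact mul_neg_le y)

/-! ### The Nelson identities in the integral case -/

theorem inf_sup_le_of_integral (h1 : ∀ x : α, x ≤ 1)
    (hN : ∀ x y : α, x * y = x * x * y ⊔ x * (y * y)) (x y z : α) :
    x ⊓ (y ⊔ z) ≤ (x ⊓ y) ⊔ (x ⊓ z) := by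
  have hl : ∀ a b : α, a * b ≤ a := fun a b => mul_le_left_of_le_one (h1 b)
  have hr : ∀ a b : α, a * b ≤ b := fun a b => mul_le_right_of_le_one (h1 a)
  -- With a, b the two sides, a·∼b = a²·∼b ∨ a·(∼b)². It suffices that a² ≤ b and (∼b)² ≤ ∼a;
  -- products distribute over joins and lie below meets.
  rw [le_iff_mul_neg, hN]
  apply sup_le
  · rw [← le_iff_mul_neg]
    calc _ ≤ x * (y ⊔ z) := mul_le_mul' inf_le_left inf_le_right
      _ = x * y ⊔ x * z := mul_sup_eq _ _ _
      _ ≤ _ := sup_le_sup (le_inf (hl _ _) (hr _ _)) (le_inf (hl _ _) (hr _ _))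
  · rw [mul_comm, ← le_neg_iff, neg_inf, neg_sup, neg_sup, neg_inf, neg_inf]
    calc _ ≤ (neg x ⊔ neg y) * (neg x ⊔ neg z) := mul_le_mul' inf_le_left inf_le_right
      _ = (neg x * neg x ⊔ neg x * neg z) ⊔ (neg y * neg x ⊔ neg y * neg z) := by
        rw [sup_mul_eq, mul_sup_eq, mul_sup_eq]
      _ ≤ _ := sup_le (le_sup_of_le_left (sup_le (hl _ _) (hl _ _)))
        (sup_le_sup (hr _ _) (le_inf (hl _ _) (hr _ _)))

/-- The identity `xy = (x ∧ e)²y ∨ x(y ∧ e)²`. -/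
def NelsonMul (α : Type*) [InvResLat α] : Prop :=
  ∀ x y : α, x * y = (x ⊓ 1) * (x ⊓ 1) * y ⊔ x * ((y ⊓ 1) * (y ⊓ 1))

theorem integral_nelson_imp (h1 : ∀ x : α, x ≤ 1) (hN : NelsonMul α) (x y : α) :
    imp (x * x) y ⊓ imp (neg y * neg y) (neg x) = imp x y := by
  apply le_antisymm
  -- Being below x → y means that the product with x·∼y is below `neg 1`. Expanding x·∼y splits this
  -- into two parts, one for each factor of the meet.
  · rw [← mul_le_iff, le_iff_mul_neg, mul_right_comm, hN x (neg y), inf_of_le_left (h1 x),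
      inf_of_le_left (h1 (neg y)), sup_mul_eq]
    apply sup_le
    · rw [mul_right_comm, ← le_iff_mul_neg, mul_le_iff]
      exact inf_le_left
    · rw [mul_assoc, mul_comm, ← le_neg_iff, mul_le_iff]
      exact inf_le_right
  · refine le_inf ?_ ?_
    · rw [← mul_le_iff, mul_assoc]
      exact (mul_le_right_of_le_one (h1 x)).trans (mul_imp_le x y)
    · rw [← mul_le_iff, le_neg_iff, mul_assoc, mul_assoc, mul_comm _ x]
      refine (mul_le_right_of_le_one (h1 _)).trans ?_
      rw [mul_comm, ← le_iff_mul_neg]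
      exact mul_imp_le x y

theorem nelsonMul_of_integral (h1 : ∀ x : α, x ≤ 1)
    (h : ∀ x y : α, imp (x * x) y ⊓ imp (neg y * neg y) (neg x) ≤ imp x y) : NelsonMul α := by
  intro x y
  rw [inf_of_le_left (h1 x), inf_of_le_left (h1 y)]
  apply le_antisymm
  -- A multiplier z sending both joinands below `neg 1` lies below both terms of the meet in `h x
  -- (neg y)`, hence below x → ∼y.
  · refine le_of_forall_mul_le fun z hz => ?_
    rw [mul_sup_eq, sup_le_iff] at hz
    have := h x (neg y)
    rw [neg_neg] at this
    have hz' : z ≤ imp x (neg y) := by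
      refine le_trans (le_inf ?_ ?_) this
      · rw [← mul_le_iff, le_neg_iff, mul_right_comm, mul_comm]
        exact hz.1
      · rw [← mul_le_iff, le_neg_iff, mul_comm _ z, mul_assoc, mul_comm _ x]
        exact hz.2
    rw [← mul_le_iff, le_neg_iff] at hz'
    rwa [mul_left_comm, ← mul_assoc]
  · refine sup_le (mul_le_mul_left (mul_le_left_of_le_one (h1 x)) y)
      (mul_le_mul_right (mul_le_left_of_le_one (h1 y)) x)

/-! ### The Nelson identities in the odd case -/

theorem odd_sq (h1 : neg (1 : α) = 1) (hN : NelsonMul α) {p : α} (hp : p ≤ 1) : p * p = p := by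
  apply le_antisymm (mul_le_left_of_le_one hp)
  have hpp : p * p ≤ 1 := (mul_le_left_of_le_one hp).trans hp
  have hn : 1 ≤ neg (p * p) := by simpa [h1] using neg_le_neg hpp
  -- As ∼(p²) ≥ 1, the second joinand of p·∼(p²) collapses to p, which is below 1 = `neg 1`.
  rw [le_iff_mul_neg, hN p, inf_of_le_left hp, inf_of_le_right hn, mul_one, mul_one]
  exact sup_le (mul_neg_le _) (by rwa [h1])

theorem odd_nelson_imp (h1 : neg (1 : α) = 1) (hN : NelsonMul α) (x y : α) :
    imp (x ⊓ 1) y ⊓ imp x (y ⊔ 1) = imp x y := by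
  apply le_antisymm
  · rw [← mul_le_iff, le_iff_mul_neg, mul_right_comm, hN x (neg y),
      odd_sq h1 hN inf_le_right, odd_sq h1 hN inf_le_right, sup_mul_eq]
    apply sup_le
    · rw [mul_right_comm, ← le_iff_mul_neg, mul_le_iff]
      exact inf_le_left
    · have : neg y ⊓ 1 = neg (y ⊔ 1) := by rw [neg_sup, h1]
      rw [mul_right_comm, this, ← le_iff_mul_neg, mul_le_iff]
      exact inf_le_right
  · refine le_inf ?_ (imp_mono_right x le_sup_left)
    rw [← mul_le_iff]
    exact (mul_le_mul_left inf_le_left _).trans (mul_imp_le x y)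

theorem nelsonMul_of_odd (h1 : neg (1 : α) = 1)
    (hs : ∀ x : α, (x ⊓ 1) * (x ⊓ 1) = x ⊓ 1)
    (h : ∀ x y : α, imp (x ⊓ 1) y ⊓ imp x (y ⊔ 1) ≤ imp x y) : NelsonMul α := by
  intro x y
  rw [hs, hs]
  apply le_antisymm
  · refine le_of_forall_mul_le fun z hz => ?_
    rw [mul_sup_eq, sup_le_iff] at hz
    have hz' : z ≤ imp x (neg y) := by
      refine le_trans (le_inf ?_ ?_) (h x (neg y))
      · rw [← mul_le_iff, le_neg_iff, mul_right_comm, mul_comm]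
        exact hz.1
      · have : neg y ⊔ 1 = neg (y ⊓ 1) := by rw [neg_inf, h1]
        rw [this, ← mul_le_iff, le_neg_iff, mul_comm x, mul_assoc]
        exact hz.2
    rw [← mul_le_iff, le_neg_iff] at hz'
    rwa [mul_left_comm, ← mul_assoc]
  · exact sup_le (mul_le_mul_left inf_le_left y) (mul_le_mul_right inf_le_left x)

/-! ### The element `neg 1` in a Nelson-type algebra -/

theorem neg_one_le_one (hN : NelsonMul α) : neg (1 : α) ≤ 1 := by
  have h : neg (1 : α) * neg 1 ≤ neg 1 := by
    have hp : (neg (1 : α) ⊓ 1) * (neg 1 ⊓ 1) ≤ 1 := (inf_one_sq_le _).trans inf_le_right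
    rw [hN (neg 1)]
    exact sup_le (mul_le_right_of_le_one hp) (mul_le_left_of_le_one hp)
  rwa [← le_neg_iff, neg_neg] at h

theorem neg_one_sq_sq (hN : NelsonMul α) :
    (neg (1 : α) * neg 1) * (neg 1 * neg 1) = neg 1 * neg 1 := by
  -- For x = y = f ≤ 1 both joinands of the Nelson identity are f³.
  have h : neg (1 : α) * neg 1 = neg 1 * neg 1 * neg 1 := by
    conv_lhs => rw [hN (neg 1), inf_of_le_left (neg_one_le_one hN), mul_comm (neg 1) (_ * _),
      sup_idem]
  rw [← mul_assoc, ← h, ← h]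

/-! ### Quotients by submonoids of the negative cone -/

/-- `x` is below `y` up to a factor in `F`. -/
def LeMod (F : Submonoid α) (x y : α) : Prop := ∃ p ∈ F, x * p ≤ y

/-- `x` and `y` are equal up to factors in `F`. -/
def modSetoid (F : Submonoid α) : Setoid α where
  r x y := LeMod F x y ∧ LeMod F y x
  iseqv := by
    have ht : ∀ {x y z : α}, LeMod F x y → LeMod F y z → LeMod F x z := by
      rintro x y z ⟨p, hp, h⟩ ⟨q, hq, h'⟩
      refine ⟨p * q, F.mul_mem hp hq, ?_⟩
      rw [← mul_assoc]
      exact (mul_le_mul_left h q).trans h'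
    have hr : ∀ x : α, LeMod F x x := fun x => ⟨1, F.one_mem, (mul_one x).le⟩
    exact ⟨fun x => ⟨hr x, hr x⟩, fun h => ⟨h.2, h.1⟩,
      fun h h' => ⟨ht h.1 h'.1, ht h'.2 h.2⟩⟩

section LeMod

variable {F : Submonoid α} {x x' y y' : α}

theorem LeMod.mul (h : LeMod F x x') (h' : LeMod F y y') : LeMod F (x * y) (x' * y') := by
  obtain ⟨p, hp, h⟩ := h
  obtain ⟨q, hq, h'⟩ := h'
  refine ⟨p * q, F.mul_mem hp hq, ?_⟩
  rw [mul_mul_mul_comm]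
  exact mul_le_mul' h h'

/-- The product pq serves as a common factor: it lies below both p and q, as F is in the negative
cone. -/
theorem LeMod.inf (hF : ∀ p ∈ F, p ≤ 1) (h : LeMod F x x') (h' : LeMod F y y') :
    LeMod F (x ⊓ y) (x' ⊓ y') := by
  obtain ⟨p, hp, h⟩ := h
  obtain ⟨q, hq, h'⟩ := h'
  refine ⟨p * q, F.mul_mem hp hq, le_inf ?_ ?_⟩
  · exact (mul_le_mul' inf_le_left (mul_le_left_of_le_one (hF q hq))).trans h
  · exact (mul_le_mul' inf_le_right (mul_le_right_of_le_one (hF p hp))).trans h'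

theorem LeMod.sup (hF : ∀ p ∈ F, p ≤ 1) (h : LeMod F x x') (h' : LeMod F y y') :
    LeMod F (x ⊔ y) (x' ⊔ y') := by
  obtain ⟨p, hp, h⟩ := h
  obtain ⟨q, hq, h'⟩ := h'
  refine ⟨p * q, F.mul_mem hp hq, ?_⟩
  rw [sup_mul_eq]
  refine sup_le_sup ?_ ?_
  · exact (mul_le_mul_right (mul_le_left_of_le_one (hF q hq)) x).trans h
  · exact (mul_le_mul_right (mul_le_right_of_le_one (hF p hp)) y).trans h'

theorem LeMod.imp (h : LeMod F x' x) (h' : LeMod F y y') : LeMod F (imp x y) (imp x' y') := by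
  obtain ⟨p, hp, h⟩ := h
  obtain ⟨q, hq, h'⟩ := h'
  refine ⟨p * q, F.mul_mem hp hq, ?_⟩
  rw [← mul_le_iff, mul_left_comm (CommResLat.imp x y), ← mul_assoc, ← mul_assoc]
  calc _ ≤ x * CommResLat.imp x y * q := mul_le_mul_left (mul_le_mul_left h _) q
    _ ≤ y * q := mul_le_mul_left (mul_imp_le x y) q
    _ ≤ y' := h'

theorem LeMod.neg (h : LeMod F x' x) : LeMod F (neg x) (neg x') := by
  rw [← imp_neg_one x, ← imp_neg_one x']
  exact h.imp ⟨1, F.one_mem, (mul_one _).le⟩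

end LeMod

/-- The elements of the negative cone above `(∼e)²`. -/
def oddSubmonoid (hN : NelsonMul α) : Submonoid α where
  carrier := {p | p ≤ 1 ∧ neg 1 * neg 1 ≤ p}
  one_mem' := ⟨le_rfl, mul_le_one' (neg_one_le_one hN) (neg_one_le_one hN)⟩
  mul_mem' := fun hp hq => ⟨mul_le_one' hp.1 hq.1,
    (neg_one_sq_sq hN).ge.trans (mul_le_mul' hp.2 hq.2)⟩

/-- The elements of the negative cone whose join with `∼e` is above `e`. -/
def integralSubmonoid (hN : NelsonMul α) : Submonoid α where
  carrier := {p | p ≤ 1 ∧ 1 ≤ neg 1 ⊔ p}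
  one_mem' := ⟨le_rfl, le_sup_right⟩
  mul_mem' := by
    rintro p q ⟨hp, hp'⟩ ⟨hq, hq'⟩
    -- Expanding (f ∨ p)(f ∨ q), every term other than pq is below f.
    refine ⟨mul_le_one' hp hq, (one_le_mul hp' hq').trans ?_⟩
    have hf := neg_one_le_one hN
    rw [sup_mul_eq, mul_sup_eq, mul_sup_eq]
    exact sup_le (le_sup_of_le_left (sup_le (mul_le_left_of_le_one hf)
      (mul_le_left_of_le_one hq))) (sup_le_sup (mul_le_right_of_le_one hp) le_rfl)

theorem le_of_leMod_of_leMod (hN : NelsonMul α) {x y : α} (h : LeMod (oddSubmonoid hN) x y)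
    (h' : LeMod (integralSubmonoid hN) x y) : x ≤ y := by
  obtain ⟨p, ⟨-, hp⟩, h⟩ := h
  obtain ⟨q, ⟨hq, hq'⟩, h'⟩ := h'
  have hf := neg_one_le_one hN
  have key : 1 ≤ p ⊔ q := by
    refine (one_le_mul hq' hq').trans ?_
    rw [sup_mul_eq, mul_sup_eq, mul_sup_eq]
    exact sup_le (sup_le (le_sup_of_le_left hp) (le_sup_of_le_right (mul_le_right_of_le_one hf)))
      (le_sup_of_le_right (sup_le (mul_le_left_of_le_one hf) (mul_le_left_of_le_one hq)))
  calc x = x * 1 := (mul_one x).symm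
    _ ≤ x * (p ⊔ q) := mul_le_mul_right key x
    _ = x * p ⊔ x * q := mul_sup_eq _ _ _
    _ ≤ y := sup_le h h'

theorem leMod_odd (hN : NelsonMul α) : LeMod (oddSubmonoid hN) 1 (neg 1) := by
  have hf := neg_one_le_one hN
  exact ⟨neg 1 * neg 1, ⟨mul_le_one' hf hf, le_rfl⟩, by
    rw [one_mul]; exact mul_le_left_of_le_one hf⟩

theorem leMod_integral (hN : NelsonMul α)
    (hd : ∀ x y z : α, x ⊓ (y ⊔ z) = (x ⊓ y) ⊔ (x ⊓ z))
    (h0 : ∀ x : α, 1 ≤ neg 1 ⊔ imp (neg 1) x) (x : α) :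
    LeMod (integralSubmonoid hN) x (x ⊓ 1) := by
  refine ⟨1 ⊓ imp (neg 1) (neg x), ⟨inf_le_left, ?_⟩, le_inf ?_ ?_⟩
  · calc 1 ≤ 1 ⊓ (neg 1 ⊔ imp (neg 1) (neg x)) := le_inf le_rfl (h0 _)
      _ = (1 ⊓ neg 1) ⊔ (1 ⊓ imp (neg 1) (neg x)) := hd _ _ _
      _ ≤ _ := sup_le_sup inf_le_right le_rfl
  · exact mul_le_left_of_le_one inf_le_left
  · refine (mul_le_mul_right inf_le_right x).trans ?_
    -- By duality, x·(f → ∼x) ≤ 1 amounts to f·(f → ∼x) ≤ ∼x.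
    rw [le_iff_mul_neg, mul_comm, ← mul_assoc, mul_right_comm, ← le_neg_iff]
    exact mul_imp_le _ _

end InvResLat

/-! ### From algebras to the type classes and back -/

/-- A commutative residuated lattice as an instance of the type class. -/
abbrev IsCommResLattice.commResLat {A : ResAlg.{u}} (h : IsCommResLattice A) :
    CommResLat A.carrier where
  le := A.le
  le_refl x := by
    have := h.inf_sup_self x (A.inf x x)
    rwa [h.sup_inf_self] at this
  le_trans x y z hxy hyz := by
    change A.inf x z = x
    rw [← show A.inf x y = x from hxy, h.inf_assoc, show A.inf y z = y from hyz]
  le_antisymm x y hxy hyx := by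
    rw [← show A.inf x y = x from hxy, h.inf_comm]
    exact hyx
  sup := A.sup
  le_sup_left := h.inf_sup_self
  le_sup_right x y := by
    change A.inf _ _ = _
    rw [h.sup_comm]
    exact h.inf_sup_self y x
  sup_le x y z hxz hyz := by
    have key : ∀ a, A.inf a z = a → A.sup a z = z := fun a ha => by
      rw [← ha, h.sup_comm, h.inf_comm, h.sup_inf_self]
    have : A.sup (A.sup x y) z = z := by rw [h.sup_assoc, key y hyz, key x hxz]
    change A.inf _ _ = _
    conv_lhs => rw [← this]
    exact h.inf_sup_self _ _
  inf := A.inf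
  inf_le_left x y := by
    change A.inf (A.inf x y) x = _
    rw [h.inf_comm, ← h.inf_assoc]
    congr 1
    have := h.inf_sup_self x (A.inf x x)
    rwa [h.sup_inf_self] at this
  inf_le_right x y := by
    change A.inf (A.inf x y) y = _
    rw [h.inf_assoc]
    congr 1
    have := h.inf_sup_self y (A.inf y y)
    rwa [h.sup_inf_self] at this
  le_inf x y z hxy hxz := by
    change A.inf x (A.inf y z) = x
    rw [← h.inf_assoc, show A.inf x y = x from hxy]
    exact hxz
  mul := A.mul
  mul_assoc := h.mul_assoc
  one := A.one
  one_mul := h.one_mul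
  mul_one x := (h.mul_comm x A.one).trans (h.one_mul x)
  mul_comm := h.mul_comm
  imp := A.imp
  mul_le_iff := h.residuation

/-- A commutative involutive residuated lattice as an instance of the type class. -/
abbrev IsCommInvResLattice.invResLat {A : InvAlg.{u}} (h : IsCommInvResLattice A) :
    InvResLat A.carrier where
  toCommResLat := h.isCommResLattice.commResLat
  neg := A.neg
  neg_neg := h.neg_neg
  imp_neg := h.contraposition

/-! ### Equational axioms for the classes involved -/

open Term in
/-- Equations for commutative residuated lattices. -/
def commResEqs : List (Term × Term) :=
  [(sup x y, sup y x), (sup (sup x y) z, sup x (sup y z)),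
   (inf x y, inf y x), (inf (inf x y) z, inf x (inf y z)),
   (sup x (inf x y), x), (inf x (sup x y), x),
   (mul (mul x y) z, mul x (mul y z)), (mul x y, mul y x), (mul one x, x),
   leEq (mul x (imp x y)) y, leEq y (imp x (mul x y)),
   leEq (mul x (inf y z)) (mul x z), leEq (imp x (inf y z)) (imp x z)]

theorem mem_models_commResEqs {A : InvAlg.{u}} :
    A ∈ models commResEqs ↔ IsCommResLattice A.toResAlg := by
  simp only [models, commResEqs, Set.mem_ofPred_eq, List.forall_mem_cons, Term.eval, Term.leEq]
  constructor
  · rintro ⟨h1, h2, h3, h4, h5, h6, h7, h8, h9, h10, h11, h12, h13, -⟩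
    -- A dummy value for the variables that an equation does not use.
    have a := A.one
    have trans : ∀ p q r, A.le p q → A.le q r → A.le p r := fun p q r hpq hqr => by
      change A.inf p r = p
      rw [← show A.inf p q = p from hpq, h4 p q r, show A.inf q r = q from hqr]
    refine ⟨fun x y => h1 x y a, h2, fun x y => h3 x y a, h4, fun x y => h5 x y a,
      fun x y => h6 x y a, h7, fun x y => h8 x y a, fun x => h9 x a a,
      fun x y z => ⟨fun h => ?_, fun h => ?_⟩⟩
    -- Residuation follows from the unit and counit inequalities once x· and x → are monotone.
    -- Monotonicity is the last two equations, stated with meets.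
    · refine trans _ _ _ (h11 x y a) ?_
      rw [← show A.inf (A.mul x y) z = _ from h]
      exact h13 x _ z
    · refine trans _ _ _ ?_ (h10 x z a)
      rw [← show A.inf y (A.imp x z) = y from h]
      exact h12 x y _
  · intro h
    let _ := h.commResLat
    refine ⟨fun x y _ => h.sup_comm x y, h.sup_assoc, fun x y _ => h.inf_comm x y, h.inf_assoc,
      fun x y _ => h.sup_inf_self x y, fun x y _ => h.inf_sup_self x y, h.mul_assoc,
      fun x y _ => h.mul_comm x y, fun x _ _ => h.one_mul x,
      fun x y _ => mul_imp_le (α := A.carrier) x y,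
      fun x y _ => le_imp_mul (α := A.carrier) x y,
      fun x y z => mul_le_mul_right (α := A.carrier) inf_le_right x,
      fun x y z => imp_mono_right (α := A.carrier) x inf_le_right, fun _ h => ?_⟩
    cases h

open Term in
/-- Equations for Nelson-type algebras, relative to commutative residuated lattices. -/
def nelsonTypeEqs : List (Term × Term) :=
  [(neg (neg x), x), (imp x (neg y), imp y (neg x)),
   (inf x (sup y z), sup (inf x y) (inf x z)),
   (mul x y, sup (mul (tw x) y) (mul x (tw y))),
   (tw (mul x y), mul (tw x) (tw y))]

theorem mem_models_nelsonTypeEqs {A : InvAlg.{u}} :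
    A ∈ models (commResEqs ++ nelsonTypeEqs) ↔ IsNelsonType A := by
  rw [mem_models_append, mem_models_commResEqs]
  simp only [models, nelsonTypeEqs, Set.mem_ofPred_eq, List.forall_mem_cons, Term.eval, Term.tw]
  constructor
  · rintro ⟨h, h1, h2, h3, h4, h5, -⟩
    have a := A.one
    exact ⟨⟨h, fun x => h1 x a a, fun x y => h2 x y a⟩, h3, fun x y => h4 x y a,
      fun x y => h5 x y a⟩
  · intro h
    refine ⟨h.1.1, fun x _ _ => h.1.2 x, fun x y _ => h.1.3 x y, h.2, fun x y _ => h.3 x y,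
      fun x y _ => h.4 x y, fun _ h => ?_⟩
    cases h

open Term in
theorem NT0_eq_models : NT0.{u} = models ((commResEqs ++ nelsonTypeEqs) ++
    [leEq one (sup (neg one) (imp (neg one) x))]) := by
  ext A
  rw [mem_models_append, mem_models_nelsonTypeEqs]
  simp only [NT0, models, Set.mem_ofPred_eq, List.forall_mem_singleton]
  exact and_congr_right fun _ => ⟨fun h x _ _ => h x, fun h x => h x x x⟩

theorem isVariety_NT0 : IsVariety NT0.{u} := by
  rw [NT0_eq_models]
  exact isVariety_models _

open Term in
/-- Equations for Nelson residuated lattices, relative to commutative residuated lattices. -/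
def nelsonResEqs : List (Term × Term) :=
  [leEq x one, leEq (neg one) x, (neg x, imp x (neg one)),
   (imp (imp x (neg one)) (neg one), x),
   (inf (imp (mul x x) y) (imp (mul (imp y (neg one)) (imp y (neg one))) (imp x (neg one))),
    imp x y)]

/-- The constant ⊥ is recoverable from the involution, since ∼e = e → ⊥ = ⊥. -/
theorem NelsonRL_eq_models : NelsonRL.{u} = models (commResEqs ++ nelsonResEqs) := by
  ext A
  rw [mem_models_append, mem_models_commResEqs]
  simp only [models, nelsonResEqs, Set.mem_ofPred_eq, List.forall_mem_cons, Term.eval, Term.leEq]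
  constructor
  · rintro ⟨B, h, rfl⟩
    have hb : B.toInv.neg B.toInv.one = B.bot := by
      let _ := h.isCommResLattice.commResLat
      exact one_imp (α := B.carrier) B.bot
    rw [hb]
    refine ⟨h.1, fun x _ _ => h.2 x, fun x _ _ => h.3 x, fun _ _ _ => rfl,
      fun x _ _ => h.4 x, fun x y _ => h.5 x y, fun _ h => ?_⟩
    cases h
  · rintro ⟨h, h1, h2, h3, h4, h5, -⟩
    have a := A.one
    refine ⟨⟨A.toResAlg, A.neg A.one⟩, ⟨h, fun x => h1 x a a, fun x => h2 x a a,
      fun x => h4 x a a, fun x y => h5 x y a⟩, ?_⟩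
    exact congrArg (InvAlg.mk A.toResAlg) (funext fun x => (h3 x a a).symm)

open Term in
/-- Equations for NPc-lattices, relative to commutative residuated lattices. -/
def npcEqs : List (Term × Term) :=
  [(inf x (sup y z), sup (inf x y) (inf x z)), (neg x, imp x one),
   (imp (imp x one) one, x),
   (inf (mul x y) one, mul (inf x one) (inf y one)),
   (mul (inf x one) (inf x one), inf x one),
   (inf (imp (inf x one) y) (imp x (sup y one)), imp x y)]

theorem NPcL_eq_models : NPcL.{u} = models (commResEqs ++ npcEqs) := by
  ext A
  rw [mem_models_append, mem_models_commResEqs]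
  simp only [models, npcEqs, Set.mem_ofPred_eq, List.forall_mem_cons, Term.eval]
  constructor
  · rintro ⟨B, h, rfl⟩
    refine ⟨h.1, h.2, fun _ _ _ => rfl, fun x _ _ => h.3 x, fun x y _ => h.4 x y,
      fun x _ _ => h.5 x, fun x y _ => h.6 x y, fun _ h => ?_⟩
    cases h
  · rintro ⟨h, h1, h2, h3, h4, h5, h6, -⟩
    have a := A.one
    refine ⟨A.toResAlg, ⟨h, h1, fun x => h3 x a a, fun x y => h4 x y a, fun x => h5 x a a,
      fun x y => h6 x y a⟩, ?_⟩
    exact congrArg (InvAlg.mk A.toResAlg) (funext fun x => (h2 x a a).symm)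

/-! ### Nelson residuated lattices and NPc-lattices as Nelson-type algebras -/

theorem NelsonRL_eq_IntegralNT : NelsonRL.{u} = IntegralNT := by
  ext A
  constructor
  · rintro ⟨B, h, rfl⟩
    have hI : IsCommInvResLattice B.toInv := by
      refine ⟨h.1, h.4, fun x y => ?_⟩
      let _ := h.isCommResLattice.commResLat
      exact imp_imp_comm (α := B.carrier) x y B.bot
    let _ := hI.invResLat
    have h1 : ∀ x : B.toInv.carrier, x ≤ 1 := h.2
    have hN : InvResLat.NelsonMul B.toInv.carrier :=
      InvResLat.nelsonMul_of_integral h1 fun x y => le_of_eq (α := B.toInv.carrier) (h.5 x y)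
    have hN' : ∀ x y : B.toInv.carrier, x * y = x * x * y ⊔ x * (y * y) := fun x y => by
      simpa only [inf_of_le_left (h1 _)] using hN x y
    refine ⟨⟨hI, fun x y z => ?_, hN, fun x y => ?_⟩, h.2⟩
    · exact le_antisymm (InvResLat.inf_sup_le_of_integral h1 hN' x y z) le_inf_sup
    · change (x * y ⊓ 1) * (x * y ⊓ 1) = (x ⊓ 1) * (x ⊓ 1) * ((y ⊓ 1) * (y ⊓ 1))
      simp only [inf_of_le_left (h1 _)]
      exact mul_mul_mul_comm x y x y
  · rintro ⟨h, h1⟩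
    let _ := h.isCommInvResLattice.invResLat
    have hneg : ∀ x : A.carrier, A.imp x (A.neg A.one) = A.neg x :=
      InvResLat.imp_neg_one (α := A.carrier)
    have hn : BddAlg.neg ⟨A.toResAlg, A.neg A.one⟩ = A.neg := funext hneg
    refine ⟨⟨A.toResAlg, A.neg A.one⟩, ⟨h.1.1, h1, fun x => ?_, ?_, ?_⟩,
      congrArg (InvAlg.mk A.toResAlg) hn⟩
    · have := InvResLat.neg_le_neg (α := A.carrier) (h1 (A.neg x))
      exact this.trans_eq (h.1.2 x)
    · rw [hn]
      exact h.1.2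
    · rw [hn]
      exact InvResLat.integral_nelson_imp (α := A.carrier) h1 h.3

theorem NPcL_eq_OddNT : NPcL.{u} = OddNT := by
  ext A
  constructor
  · rintro ⟨B, h, rfl⟩
    have hI : IsCommInvResLattice B.toInv := by
      refine ⟨h.1, h.3, fun x y => ?_⟩
      let _ := h.isCommResLattice.commResLat
      exact imp_imp_comm (α := B.carrier) x y B.one
    let _ := hI.invResLat
    have h1 : B.toInv.neg B.toInv.one = B.toInv.one := one_imp (α := B.toInv.carrier) 1
    have hs : ∀ x, B.toInv.tw x = B.inf x B.one := h.5
    refine ⟨⟨hI, h.2, InvResLat.nelsonMul_of_odd (α := B.toInv.carrier) h1 h.5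
      fun x y => le_of_eq (α := B.toInv.carrier) (h.6 x y), fun x y => ?_⟩, h1⟩
    rw [hs, hs, hs]
    exact h.4 x y
  · rintro ⟨h, h1⟩
    let _ := h.isCommInvResLattice.invResLat
    have hneg : ∀ x : A.carrier, A.imp x A.one = A.neg x := fun x => by
      conv_lhs => rw [← h1]
      exact InvResLat.imp_neg_one (α := A.carrier) x
    have hn : A.oddNeg = A.neg := funext hneg
    have hs : ∀ x, A.tw x = A.inf x A.one := fun x =>
      InvResLat.odd_sq (α := A.carrier) h1 h.3 inf_le_right
    refine ⟨A.toResAlg, ⟨h.1.1, h.2, ?_, fun x y => ?_, hs, ?_⟩,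
      congrArg (InvAlg.mk A.toResAlg) hn⟩
    · rw [hn]
      exact h.1.2
    · rw [← hs, ← hs, ← hs]
      exact h.4 x y
    · exact InvResLat.odd_nelson_imp (α := A.carrier) h1 h.3

/-- Here ∼e is the least element, so ∼e → x is already above e. -/
theorem IntegralNT_subset_NT0 : IntegralNT.{u} ⊆ NT0 := by
  rintro A ⟨h, h1⟩
  let _ := h.isCommInvResLattice.invResLat
  refine ⟨h, fun x => ?_⟩
  refine le_sup_of_le_right (α := A.carrier) ((mul_le_iff (α := A.carrier) _ _ _).1 ?_)
  rw [InvResLat.le_iff_mul_neg]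
  exact (mul_le_left_of_le_one (h1 _)).trans (mul_one _).le

theorem OddNT_subset_NT0 : OddNT.{u} ⊆ NT0 := by
  rintro A ⟨h, h1⟩
  let _ := h.isCommInvResLattice.invResLat
  refine ⟨h, fun x => ?_⟩
  exact le_sup_of_le_left (α := A.carrier) (ge_of_eq h1)

/-! ### The subdirect decomposition -/

open InvResLat in
/-- The quotient of an algebra by a submonoid of its negative cone. -/
def quotientAlg (A : InvAlg.{u}) (h : IsCommInvResLattice A)
    (F : letI := h.invResLat; Submonoid A.carrier)
    (hF : letI := h.invResLat; ∀ p ∈ F, p ≤ 1) : InvAlg.{u} :=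
  letI := h.invResLat
  { carrier := Quotient (modSetoid F)
    sup := Quotient.map₂ A.sup fun _ _ h _ _ h' => ⟨h.1.sup hF h'.1, h.2.sup hF h'.2⟩
    inf := Quotient.map₂ A.inf fun _ _ h _ _ h' => ⟨h.1.inf hF h'.1, h.2.inf hF h'.2⟩
    mul := Quotient.map₂ A.mul fun _ _ h _ _ h' => ⟨h.1.mul h'.1, h.2.mul h'.2⟩
    imp := Quotient.map₂ A.imp fun _ _ h _ _ h' => ⟨h.2.imp h'.1, h.1.imp h'.2⟩
    one := Quotient.mk _ A.one
    neg := Quotient.map A.neg fun _ _ h => ⟨h.2.neg, h.1.neg⟩ }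

/-- The quotient map. -/
def quotientMap (A : InvAlg.{u}) (h : IsCommInvResLattice A)
    (F : letI := h.invResLat; Submonoid A.carrier)
    (hF : letI := h.invResLat; ∀ p ∈ F, p ≤ 1) (x : A.carrier) :
    (quotientAlg A h F hF).carrier :=
  letI := h.invResLat
  Quotient.mk (InvResLat.modSetoid F) x

section quotient

variable {A : InvAlg.{u}} {h : IsCommInvResLattice A}
  {F : letI := h.invResLat; Submonoid A.carrier} {hF : letI := h.invResLat; ∀ p ∈ F, p ≤ 1}

theorem isHom_quotientMap : IsHom A (quotientAlg A h F hF) (quotientMap A h F hF) where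
  map_sup _ _ := rfl
  map_inf _ _ := rfl
  map_mul _ _ := rfl
  map_imp _ _ := rfl
  map_one := rfl
  map_neg _ := rfl

theorem quotientMap_surjective : Function.Surjective (quotientMap A h F hF) :=
  Quotient.mk_surjective

theorem quotientMap_eq_iff {x y : A.carrier} :
    letI := h.invResLat
    quotientMap A h F hF x = quotientMap A h F hF y ↔
      InvResLat.LeMod F x y ∧ InvResLat.LeMod F y x :=
  let _ := h.invResLat
  Quotient.eq (r := InvResLat.modSetoid F)

/-- No axiom has to be checked on the quotient: equations pass to homomorphic images. -/
theorem isNelsonType_quotientAlg (hA : IsNelsonType A) : IsNelsonType (quotientAlg A h F hF) :=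
  mem_models_nelsonTypeEqs.1 <| (isVariety_models _).image _ _ _ isHom_quotientMap
    quotientMap_surjective (mem_models_nelsonTypeEqs.2 hA)

end quotient

theorem IsVariety.mem_of_two_quotients {V : Set InvAlg.{u}} (hV : IsVariety V)
    {A B C : InvAlg.{u}} {f : A.carrier → B.carrier} {g : A.carrier → C.carrier}
    (hf : IsHom A B f) (hg : IsHom A C g) (hB : B ∈ V) (hC : C ∈ V)
    (hinj : ∀ x y, f x = f y → g x = g y → x = y) : A ∈ V := by
  -- `ULift` puts the two-element index type in the universe that `prod` requires.
  let D : ULift.{u} Bool → InvAlg.{u} := fun i => bif i.down then B else C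
  have hD : prod D ∈ V := hV.product _ _ (by rintro ⟨_ | _⟩ <;> assumption)
  let k : ∀ (b : Bool), A.carrier → (D ⟨b⟩).carrier := fun b => match b with
    | true => f
    | false => g
  have hk : ∀ b, IsHom A (D ⟨b⟩) (k b) := by rintro (_ | _) <;> assumption
  refine hV.subalgebra (prod D) A (fun x (i : ULift Bool) => k i.down x)
    ⟨?_, ?_, ?_, ?_, ?_, ?_⟩ ?_ hD
  · exact fun x y => funext fun i : ULift Bool => (hk i.down).map_sup x y
  · exact fun x y => funext fun i : ULift Bool => (hk i.down).map_inf x y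
  · exact fun x y => funext fun i : ULift Bool => (hk i.down).map_mul x y
  · exact fun x y => funext fun i : ULift Bool => (hk i.down).map_imp x y
  · exact funext fun i : ULift Bool => (hk i.down).map_one
  · exact fun x => funext fun i : ULift Bool => (hk i.down).map_neg x
  · exact fun x y hxy => hinj x y (congrFun hxy ⟨true⟩) (congrFun hxy ⟨false⟩)

open InvResLat in
theorem NT0_subset_of_isVariety {V : Set InvAlg.{u}} (hV : IsVariety V)
    (hI : IntegralNT ⊆ V) (hO : OddNT ⊆ V) : NT0 ⊆ V := by
  rintro A ⟨hA, h0⟩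
  have h := hA.isCommInvResLattice
  let _ := h.invResLat
  have hN : NelsonMul A.carrier := hA.mul_eq
  have hF : ∀ p ∈ oddSubmonoid hN, p ≤ 1 := fun p hp => hp.1
  have hG : ∀ p ∈ integralSubmonoid hN, p ≤ 1 := fun p hp => hp.1
  refine hV.mem_of_two_quotients (isHom_quotientMap (h := h) (hF := hF))
    (isHom_quotientMap (h := h) (hF := hG)) (hO ⟨isNelsonType_quotientAlg hA, ?_⟩)
    (hI ⟨isNelsonType_quotientAlg hA, ?_⟩) fun x y hxy hxy' => ?_
  -- Oddness: ∼e and e are identified modulo `oddSubmonoid`.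
  · exact (quotientMap_eq_iff (hF := hF)).2
      ⟨⟨1, Submonoid.one_mem _, (mul_one _).le.trans (neg_one_le_one hN)⟩, leMod_odd hN⟩
  -- Integrality: x ∧ e and x are identified modulo `integralSubmonoid`.
  · intro x
    obtain ⟨x, rfl⟩ := quotientMap_surjective x
    exact (quotientMap_eq_iff (hF := hG)).2
      ⟨⟨1, Submonoid.one_mem _, (mul_one _).le.trans inf_le_left⟩,
        leMod_integral hN hA.isDistrib h0 x⟩
  · rw [quotientMap_eq_iff] at hxy hxy'
    exact le_antisymm (le_of_leMod_of_leMod hN hxy.1 hxy'.1)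
      (le_of_leMod_of_leMod hN hxy.2 hxy'.2)

theorem NT0_eq_generatedVariety : NT0.{u} = generatedVariety (IntegralNT ∪ OddNT) := by
  apply Set.Subset.antisymm
  · intro A hA V hV hK
    rw [Set.union_subset_iff] at hK
    exact NT0_subset_of_isVariety hV hK.1 hK.2 hA
  · intro A hA
    exact hA NT0 isVariety_NT0 (Set.union_subset IntegralNT_subset_NT0 OddNT_subset_NT0)

end NelsonType

theorem mainTheorem12 :
    NelsonType.IsVariety NelsonType.NT0.{u} ∧
    NelsonType.NT0.{u} =
      NelsonType.generatedVariety (NelsonType.IntegralNT.{u} ∪ NelsonType.OddNT.{u}) ∧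
    NelsonType.IsVariety NelsonType.NelsonRL.{u} ∧
    NelsonType.IsVariety NelsonType.NPcL.{u} ∧
    NelsonType.NT0.{u} =
      NelsonType.varietyJoin NelsonType.NelsonRL.{u} NelsonType.NPcL.{u} := by
  refine ⟨NelsonType.isVariety_NT0, NelsonType.NT0_eq_generatedVariety, ?_, ?_, ?_⟩
  · rw [NelsonType.NelsonRL_eq_models]
    exact NelsonType.isVariety_models _
  · rw [NelsonType.NPcL_eq_models]
    exact NelsonType.isVariety_models _
  · rw [NelsonType.varietyJoin, NelsonType.NelsonRL_eq_IntegralNT, NelsonType.NPcL_eq_OddNT]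
    exact NelsonType.NT0_eq_generatedVariety
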